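/- For $f:\{0,1\}^n\to Y$ with $Y$ finite, say that $f$ depends on all $n$ variables if for every $i\in\{1,\dots,n\}$ there is an input $x$ such that flipping the $i$-th bit of $x$ changes $f(x)$. Let $Q_2(f)$ be the least number of queries $|i,b,w\rangle\mapsto|i,b\oplus x_i,w\rangle$ made by a quantum algorithm that on every input $x$ outputs $f(x)$ with probability at least $2/3$. For $f:\{0,1\}^n\to\{0,1\}$ let $\widetilde{\deg}(f)$ be the least degree of a real multilinear polynomial $p$ with $|f(x)-p(x)|\le 1/3$ for all $x\in\{0,1\}^n$. A $k$-addressing scheme on $m$ bits is a surjective function $a:\{0,1\}^m\to\{1,\dots,k\}$, and its address function is $f_a:\{0,1\}^{k+m}\to\{0,1\}$, $f_a(x_1,\dots,x_{k+m})=x_{a(x_{k+1},\dots,x_{k+m})}$. Logarithms are to base $2$. Theorem. There is an absolute constant $C$ such that the following hold. (1) For every $n\ge 3$ there is a Boolean function $f:\{0,1\}^n\to\{0,1\}$ that depends on all $n$ variables and satisfies $$Q_2(f)\le C\,\frac{\log n}{\log\log n}\qquad\text{and}\qquad \widetilde{\deg}(f)\le C\,\frac{\log n}{\log\log n}.$$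 (2) Such functions can be obtained as address functions: for every integer $t\ge 2$ there is a $t^t$-addressing scheme $a$ on $t^2$ bits that depends on all its $t^2$ variables and has $Q_2(a)\le C\,t$, and whose address function $f_a$, a Boolean function of $n=t^t+t^2$ variables, depends on all $n$ variables and satisfies $Q_2(f_a)\le C\,\log n/\log\log n$ and $\widetilde{\deg}(f_a)\le C\,\log n/\log\log n$. -/

import Mathlib

open scoped ENNReal

/-- The function `f` on the Boolean cube depends on every one of its `n` variables: for each `i`
there is an input `x` on which flipping the bit `x i` changes the value of `f`. -/
def DependsOnAll {n : ℕ} {β : Type} (f : (Fin n → Bool) → β) : Prop :=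
  ∀ i : Fin n, ∃ x : Fin n → Bool, f x ≠ f (Function.update x i (!x i))

/-- A quantum query algorithm on `n`-bit inputs with outputs in `β`.
The computational basis states are `|i, b, w⟩` with a query index `i : Fin n`, a target bit `b`
and a workspace value `w` in a finite set `W`. The algorithm starts in a basis state, alternates
the input-independent unitaries `U 0, U 1, …` with queries to the input, and finally measures in
the computational basis and applies `out` to the measured basis state. -/
structure QueryAlgorithm (n : ℕ) (β : Type) where
  W : Type
  fintypeW : Fintype W
  decEqW : DecidableEq W
  start : Fin n × Bool × W
  U : ℕ → Matrix.unitaryGroup (Fin n × Bool × W) ℂ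
  out : Fin n × Bool × W → β

namespace QueryAlgorithm

attribute [instance] QueryAlgorithm.fintypeW QueryAlgorithm.decEqW

variable {n : ℕ} {β : Type}

/-- One query to the input `x`: the unitary map `|i, b, w⟩ ↦ |i, b ⊕ x i, w⟩`, written on
amplitude vectors (it is its own inverse). -/
def query {W : Type} (x : Fin n → Bool) (ψ : Fin n × Bool × W → ℂ) : Fin n × Bool × W → ℂ :=
  fun z => ψ (z.1, xor z.2.1 (x z.1), z.2.2)

/-- The state after `T` queries, `U_T O_x U_{T-1} O_x ⋯ O_x U_0 |start⟩`. -/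
noncomputable def state (A : QueryAlgorithm n β) (x : Fin n → Bool) :
    ℕ → (Fin n × Bool × A.W → ℂ)
  | 0 => Matrix.mulVec (A.U 0).1 (Pi.single A.start 1)
  | T + 1 => Matrix.mulVec (A.U (T + 1)).1 (query x (A.state x T))

/-- The probability that the algorithm, stopped after `T` queries to `x`, outputs `y`. -/
noncomputable def outputProb [DecidableEq β] (A : QueryAlgorithm n β) (T : ℕ)
    (x : Fin n → Bool) (y : β) : ℝ :=
  ∑ z : Fin n × Bool × A.W, if A.out z = y then ‖A.state x T z‖ ^ 2 else 0

/-- With `T` queries the algorithm computes `f` with error probability at most `1/3` on every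
input. -/
def Computes [DecidableEq β] (A : QueryAlgorithm n β) (T : ℕ) (f : (Fin n → Bool) → β) : Prop :=
  ∀ x : Fin n → Bool, 2 / 3 ≤ A.outputProb T x (f x)

end QueryAlgorithm

/-- The bounded-error quantum query complexity `Q₂(f)`: the least number of queries of a quantum
algorithm that computes `f` with error probability at most `1/3` on every input
(`⊤` if there were no such algorithm). -/
noncomputable def Q2 {n : ℕ} {β : Type} [DecidableEq β] (f : (Fin n → Bool) → β) : ℕ∞ :=
  ⨅ (T : ℕ) (_ : ∃ A : QueryAlgorithm n β, A.Computes T f), (T : ℕ∞)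

/-- The value at `x ∈ {0,1}ⁿ` of the multilinear polynomial `∑_S a_S ∏_{i ∈ S} x_i`. -/
noncomputable def multilinearEval {n : ℕ} (a : Finset (Fin n) → ℝ) (x : Fin n → Bool) : ℝ :=
  ∑ S : Finset (Fin n), a S * ∏ i ∈ S, (if x i then 1 else 0)

/-- The degree `max {|S| : a_S ≠ 0}` of the multilinear polynomial with coefficients `a`
(`0` for the zero polynomial). -/
noncomputable def multilinearDegree {n : ℕ} (a : Finset (Fin n) → ℝ) : ℕ :=
  open Classical in (Finset.univ.filter fun S => a S ≠ 0).sup Finset.card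

/-- The approximate degree of `f`: the least degree of a real multilinear polynomial that differs
from `f` by at most `1/3` at every point of the Boolean cube. -/
noncomputable def approxDegree {n : ℕ} (f : (Fin n → Bool) → Bool) : ℕ∞ :=
  ⨅ (a : Finset (Fin n) → ℝ)
    (_ : ∀ x, |(if f x then 1 else 0) - multilinearEval a x| ≤ 1 / 3), (multilinearDegree a : ℕ∞)

/-- A `k`-addressing scheme on `m` bits: every `m`-bit string addresses one of `k` indices, and
every index is addressed by some string. -/
def IsAddressingScheme {m k : ℕ} (a : (Fin m → Bool) → Fin k) : Prop :=
  Function.Surjective a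

/-- The address function of `a`: the last `m` bits of the input address one of the first `k` bits,
whose value is the value of the function. -/
def addressFunction {m k : ℕ} (a : (Fin m → Bool) → Fin k) : (Fin (k + m) → Bool) → Bool :=
  fun x => x (Fin.castAdd m (a fun j => x (Fin.natAdd k j)))

/-- The real number `log n / log log n`, logarithms to base `2` (used for `n ≥ 3`, where
`log log n > 0`). -/
noncomputable def logRatio (n : ℕ) : ℝ :=
  Real.logb 2 n / Real.logb 2 (Real.logb 2 n)

/-!
The address is written in a code that a quantum algorithm decodes with few queries, and strings
that are not code words are sent to a default address. The `t ^ 2` address bits form `t` blocks of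
`t` bits. Each block holds a word of a Hadamard code with one extra bit in the clear, so that it
names one of at least `t` values, and on code words the Bernstein–Vazirani algorithm reads a block
with two queries and without error (`hadamard_mulVec_phase`, `exists_code`). On an arbitrary
string these `2 t` queries produce a superposition of guesses. A Grover search over all `t ^ 2`
positions, controlled by the guess, then tests with `2 t` further queries whether the input is the
guessed code word (`Solves.of_code`). Hence `4 t` queries compute the address, one more looks up
the addressed bit (`Solves.lookup`), and `t = O(log n / log log n)` (`le_logRatio`). Flipping any
bit of a code word with a non-default address changes the address, since the code is injective; this
is why all variables matter.

The Grover test needs no knowledge of the number of mismatches. A counter register in uniform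
superposition over `m < M` controls the application of `G ^ m` to the uniform state `s`, and the
counter is measured in a basis that contains its uniform state. If there is no mismatch then
`G s = s` and the uniform state is observed with certainty. Otherwise the position
register is left in `M⁻¹ ∑ m < M, G ^ m s`; since `s = u - G u` for an explicit `u` of norm at most
`√N / 2`, the sum telescopes and the probability is at most `N / M ^ 2` (`sum_norm_sq_sum_grover_pow_le`).

Algorithms are described by the inductive predicate `Prepares`, with phase queries on an arbitrary
finite basis, and compiled to the query model by phase kickback (`Prepares.exists_state`). The
bound on the approximate degree follows from that on the number of queries, because the amplitudes
after `T` queries are polynomials of degree at most `T` in the input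
(`QueryAlgorithm.Computes.approxDegree_le`). For `n ≥ 18` one uses the address functions with
`n - t ^ 2` addresses for suitable `t`, and for smaller `n` the conjunction of all variables.
-/

/-! ### Unitary matrices -/

section Unitary

variable {A B Z : Type} [Fintype A] [DecidableEq A] [Fintype B] [DecidableEq B]
  [Fintype Z] [DecidableEq Z]

theorem sum_norm_sq_mulVec (U : Matrix.unitaryGroup Z ℂ) (ψ : Z → ℂ) :
    ∑ z, ‖(U.1.mulVec ψ) z‖ ^ 2 = ∑ z, ‖ψ z‖ ^ 2 := by
  have key : ∀ φ : Z → ℂ, ((∑ z, ‖φ z‖ ^ 2 : ℝ) : ℂ) = dotProduct (star φ) φ := by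
    intro φ
    simp [dotProduct, Complex.conj_mul']
  have h : dotProduct (star (U.1.mulVec ψ)) (U.1.mulVec ψ) = dotProduct (star ψ) ψ := by
    rw [Matrix.star_mulVec, Matrix.dotProduct_mulVec, Matrix.vecMul_vecMul,
      ← Matrix.star_eq_conjTranspose, Matrix.UnitaryGroup.star_mul_self, Matrix.vecMul_one]
  have := (key _).trans (h.trans (key _).symm)
  exact_mod_cast this

/-- Every unit vector is the image of a given basis vector under some unitary matrix. -/
theorem exists_unitary_mulVec_single (z₀ : Z) (w : Z → ℂ) (hw : ∑ z, ‖w z‖ ^ 2 = 1) :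
    ∃ U : Matrix.unitaryGroup Z ℂ, U.1.mulVec (Pi.single z₀ 1) = w := by
  have hnorm : ‖WithLp.toLp 2 w‖ = 1 := by
    rw [EuclideanSpace.norm_eq]; simp [hw]
  have hv : Orthonormal ℂ (({z₀} : Set Z).domRestrict fun _ => WithLp.toLp 2 w) := by
    constructor
    · intro i; exact hnorm
    · intro i j hij; exact absurd (Subsingleton.elim i j) hij
  obtain ⟨b, hb⟩ := hv.exists_orthonormalBasis_extension_of_card_eq (by simp)
  refine ⟨⟨(EuclideanSpace.basisFun Z ℂ).toBasis.toMatrix b,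
    (EuclideanSpace.basisFun Z ℂ).toMatrix_orthonormalBasis_mem_unitary b⟩, ?_⟩
  ext z
  simp [Module.Basis.toMatrix_apply, hb z₀ rfl]

/-- The controlled unitary that applies `U b` to the register `A` when the register `B` holds
`b`; the equivalence `e` splits the basis `Z` into the two registers. -/
def controlled (e : Z ≃ A × B) (U : B → Matrix.unitaryGroup A ℂ) : Matrix.unitaryGroup Z ℂ :=
  ⟨(Matrix.blockDiagonal fun b => (U b).1).submatrix e e, by
    rw [Matrix.mem_unitaryGroup_iff, Matrix.star_eq_conjTranspose, Matrix.conjTranspose_submatrix,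
      Matrix.submatrix_mul_equiv, Matrix.blockDiagonal_conjTranspose, ← Matrix.blockDiagonal_mul]
    have : (fun b => (U b).1 * ((U b).1).conjTranspose) = 1 := by
      funext b
      exact Matrix.mem_unitaryGroup_iff.1 (U b).2
    rw [this, Matrix.blockDiagonal_one, Matrix.submatrix_one_equiv]⟩

theorem controlled_mulVec (e : Z ≃ A × B) (U : B → Matrix.unitaryGroup A ℂ) (ψ : Z → ℂ) (z : Z) :
    (controlled e U).1.mulVec ψ z =
      (U (e z).2).1.mulVec (fun a => ψ (e.symm (a, (e z).2))) (e z).1 := by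
  simp only [controlled, Matrix.mulVec, dotProduct, Matrix.submatrix_apply,
    Matrix.blockDiagonal_apply]
  rw [← e.symm.sum_comp]
  simp [Fintype.sum_prod_type]

end Unitary

/-! ### State families prepared by phase queries -/

/-- The sign `-1` of a set bit and `1` of an unset bit. -/
def bitSign (b : Bool) : ℤˣ := if b then -1 else 1

/-- The phase `(-1) ^ x i` that a query to the bit `i` kicks back; `none` stands for no query. -/
def phase {n : ℕ} (x : Fin n → Bool) (o : Option (Fin n)) : ℤˣ := o.elim 1 fun i => bitSign (x i)

/-- `Prepares T ψ`: starting in a basis state, the states `ψ x` are produced, uniformly in the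
input `x`, by input-independent unitaries and `T` phase queries. In a phase query the basis state
`z` is multiplied by the phase of the bit `q z`, or left alone when `q z = none`. -/
inductive Prepares {n : ℕ} {Z : Type} [Fintype Z] [DecidableEq Z] :
    ℕ → ((Fin n → Bool) → Z → ℂ) → Prop
  | basis (z₀ : Z) : Prepares 0 fun _ => Pi.single z₀ 1
  | unitary {T : ℕ} {ψ : (Fin n → Bool) → Z → ℂ} (U : Matrix.unitaryGroup Z ℂ) :
      Prepares T ψ → Prepares T fun x => U.1.mulVec (ψ x)
  | query {T : ℕ} {ψ : (Fin n → Bool) → Z → ℂ} (q : Z → Option (Fin n)) :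
      Prepares T ψ → Prepares (T + 1) fun x z => ((phase x (q z) : ℤ) : ℂ) * ψ x z

@[simp]
theorem norm_intUnit (u : ℤˣ) : ‖((u : ℤ) : ℂ)‖ = 1 := by
  rcases Int.units_eq_one_or u with rfl | rfl <;> simp

namespace Prepares

variable {n T : ℕ} {Z : Type} [Fintype Z] [DecidableEq Z] {ψ : (Fin n → Bool) → Z → ℂ}

theorem sum_norm_sq (h : Prepares T ψ) (x : Fin n → Bool) : ∑ z, ‖ψ x z‖ ^ 2 = 1 := by
  induction h with
  | basis z₀ =>
    rw [Finset.sum_eq_single z₀] <;> simp +contextual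
  | unitary U _ ih => rw [sum_norm_sq_mulVec, ih]
  | query q _ ih => simpa only [norm_mul, norm_intUnit, one_mul] using ih

/-- Several queries in a row, one for each element of `s`. -/
theorem queries {ι : Type} (h : Prepares T ψ) (s : Finset ι) (q : ι → Z → Option (Fin n)) :
    Prepares (T + s.card) fun x z => (((∏ i ∈ s, phase x (q i z) : ℤˣ) : ℤ) : ℂ) * ψ x z := by
  classical
  induction s using Finset.induction_on with
  | empty => simpa using h
  | insert i s hi ih =>
    have := ih.query (q i)
    rw [Finset.card_insert_of_notMem hi, ← add_assoc]
    convert this using 3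
    rw [Finset.prod_insert hi]
    push_cast
    ring

/-- A fresh register `B` in the basis state `b₀` may be added. -/
theorem addRegister {B : Type} [Fintype B] [DecidableEq B] (h : Prepares T ψ) (b₀ : B) :
    Prepares T fun x (z : Z × B) => ψ x z.1 * (Pi.single b₀ 1 : B → ℂ) z.2 := by
  induction h with
  | basis z₀ =>
    convert Prepares.basis (n := n) ((z₀, b₀) : Z × B) using 3 with x z
    obtain ⟨z, b⟩ := z
    by_cases h₁ : z = z₀ <;> by_cases h₂ : b = b₀ <;> simp [h₁, h₂]
  | unitary U _ ih =>
    convert ih.unitary (controlled (Equiv.refl _) fun _ => U) using 3 with x z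
    rw [controlled_mulVec]
    simp only [Matrix.mulVec, dotProduct, Equiv.refl_apply, Equiv.refl_symm, Finset.sum_mul,
      mul_assoc]
  | query q _ ih =>
    convert ih.query (fun z => q z.1) using 3
    rw [mul_assoc]

end Prepares

/-! ### Compilation to query algorithms -/

section Compile

variable {n T : ℕ} {Z β : Type} [Fintype Z] [DecidableEq Z]

theorem QueryAlgorithm.state_congr (start : Fin n × Bool × Z)
    (U U' : ℕ → Matrix.unitaryGroup (Fin n × Bool × Z) ℂ) (out : Fin n × Bool × Z → β)
    (h : ∀ k ≤ T, U k = U' k) (x : Fin n → Bool) :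
    (QueryAlgorithm.mk Z inferInstance inferInstance start U out).state x T =
      (QueryAlgorithm.mk Z inferInstance inferInstance start U' out).state x T := by
  induction T with
  | zero => simp [state, h 0 le_rfl]
  | succ T ih =>
    simp only [state]
    rw [ih fun k hk => h k (hk.trans (Nat.le_succ T)), h (T + 1) le_rfl]

/-- Appending the unitary `L` to the last unitary applies `L` to the final state. -/
theorem QueryAlgorithm.state_update (start : Fin n × Bool × Z)
    (U : ℕ → Matrix.unitaryGroup (Fin n × Bool × Z) ℂ) (out : Fin n × Bool × Z → β)
    (L : Matrix.unitaryGroup (Fin n × Bool × Z) ℂ) (x : Fin n → Bool) :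
    (QueryAlgorithm.mk Z inferInstance inferInstance start
        (Function.update U T (L * U T)) out).state x T =
      L.1.mulVec ((QueryAlgorithm.mk Z inferInstance inferInstance start U out).state x T) := by
  cases T with
  | zero =>
    simp only [state, Function.update_self, Matrix.mulVec_mulVec]
    rfl
  | succ T =>
    simp only [state]
    rw [state_congr (U' := U)]
    · simp [Matrix.mulVec_mulVec]
    · intro k hk
      rw [Function.update_of_ne (by omega)]

/-- The state of the query and target registers that turns a query into the phase of `o`: the
target is in the state `|+⟩` (insensitive to queries) if `o = none`, and in `|-⟩` with the query
register holding `i` if `o = some i`. -/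
noncomputable def kickback (i₀ : Fin n) (o : Option (Fin n)) (y : Fin n × Bool) : ℂ :=
  if y.1 = o.getD i₀ then ((Real.sqrt 2)⁻¹ : ℝ) * ((o.elim 1 fun _ => bitSign y.2 : ℤˣ) : ℤ) else 0

theorem sum_norm_sq_kickback (i₀ : Fin n) (o : Option (Fin n)) :
    ∑ y, ‖kickback i₀ o y‖ ^ 2 = 1 := by
  have h : ∀ y, ‖kickback i₀ o y‖ ^ 2 = if y.1 = o.getD i₀ then (1 / 2 : ℝ) else 0 := by
    intro y
    unfold kickback
    split_ifs
    · rw [norm_mul, norm_intUnit, Complex.norm_real]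
      simp
    · simp
  simp only [h, Fintype.sum_prod_type]
  simp

theorem kickback_xor (i₀ : Fin n) (o : Option (Fin n)) (x : Fin n → Bool) (i : Fin n) (b : Bool) :
    kickback i₀ o (i, xor b (x i)) = ((phase x o : ℤ) : ℂ) * kickback i₀ o (i, b) := by
  unfold kickback phase
  cases o with
  | none => simp
  | some j =>
    by_cases h : i = j
    · subst h
      cases b <;> cases hx : x i <;> simp [bitSign, hx]
    · simp [h]

/-- Phase queries are simulated by the queries `|i, b, w⟩ ↦ |i, b ⊕ x i, w⟩`. -/
theorem Prepares.exists_state {ψ : (Fin n → Bool) → Z → ℂ} (h : Prepares T ψ) (i₀ : Fin n)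
    (out : Fin n × Bool × Z → β) :
    ∃ (z₀ : Z) (U : ℕ → Matrix.unitaryGroup (Fin n × Bool × Z) ℂ), ∀ x,
      (QueryAlgorithm.mk Z inferInstance inferInstance (i₀, false, z₀) U out).state x T =
        fun y => (Pi.single (i₀, false) 1 : Fin n × Bool → ℂ) (y.1, y.2.1) * ψ x y.2.2 := by
  induction h with
  | basis z₀ =>
    refine ⟨z₀, fun _ => 1, fun x => ?_⟩
    funext ⟨i, b, z⟩
    simp only [QueryAlgorithm.state, OneMemClass.coe_one, Matrix.one_mulVec]
    by_cases h₁ : i = i₀ <;> by_cases h₂ : b = false <;> by_cases h₃ : z = z₀ <;>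
      simp [h₁, h₂, h₃]
  | @unitary T ψ V _ ih =>
    obtain ⟨z₀, U, hU⟩ := ih
    set L : Matrix.unitaryGroup (Fin n × Bool × Z) ℂ :=
      controlled ((Equiv.prodAssoc (Fin n) Bool Z).symm.trans (Equiv.prodComm _ _)) fun _ => V
      with hL
    refine ⟨z₀, Function.update U T (L * U T), fun x => ?_⟩
    rw [QueryAlgorithm.state_update, hU]
    funext ⟨i, b, z⟩
    rw [hL, controlled_mulVec]
    simp only [Matrix.mulVec, dotProduct, Finset.mul_sum]
    refine Finset.sum_congr rfl fun w _ => ?_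
    simp
    ring
  | @query T ψ q _ ih =>
    obtain ⟨z₀, U, hU⟩ := ih
    choose K hK using fun o : Option (Fin n) =>
      exists_unitary_mulVec_single (i₀, false) (kickback i₀ o) (sum_norm_sq_kickback i₀ o)
    set L : Matrix.unitaryGroup (Fin n × Bool × Z) ℂ :=
      controlled (Equiv.prodAssoc (Fin n) Bool Z).symm fun z => K (q z) with hL
    have hLmul : ∀ φ : Z → ℂ, L.1.mulVec (fun y : Fin n × Bool × Z =>
        (Pi.single (i₀, false) 1 : Fin n × Bool → ℂ) (y.1, y.2.1) * φ y.2.2) =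
        fun y => kickback i₀ (q y.2.2) (y.1, y.2.1) * φ y.2.2 := by
      intro φ
      funext ⟨i, b, z⟩
      rw [hL, controlled_mulVec, ← hK (q z)]
      simp only [Matrix.mulVec, dotProduct, Finset.sum_mul, mul_assoc]
      rfl
    refine ⟨z₀, Function.update (Function.update U T (L * U T)) (T + 1) (star L), fun x => ?_⟩
    have hq : QueryAlgorithm.query x (fun y : Fin n × Bool × Z =>
          kickback i₀ (q y.2.2) (y.1, y.2.1) * ψ x y.2.2) =
        L.1.mulVec (fun y : Fin n × Bool × Z => (Pi.single (i₀, false) 1 : Fin n × Bool → ℂ)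
          (y.1, y.2.1) * (((phase x (q y.2.2) : ℤ) : ℂ) * ψ x y.2.2)) := by
      rw [hLmul fun z => ((phase x (q z) : ℤ) : ℂ) * ψ x z]
      funext ⟨i, b, z⟩
      simp only [QueryAlgorithm.query]
      rw [kickback_xor]
      ring
    simp only [QueryAlgorithm.state]
    rw [QueryAlgorithm.state_congr (U' := Function.update U T (L * U T))
      (h := fun k hk => by rw [Function.update_of_ne (by omega)]), QueryAlgorithm.state_update,
      hU, hLmul, hq]
    simp [Matrix.mulVec_mulVec]

/-- `Solves T f`: some family of states prepared with `T` phase queries, measured in the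
computational basis, yields `f x` with probability at least `2/3` on every input `x`. -/
def Solves [DecidableEq β] (T : ℕ) (f : (Fin n → Bool) → β) : Prop :=
  ∃ (Z : Type) (_ : Fintype Z) (_ : DecidableEq Z) (ψ : (Fin n → Bool) → Z → ℂ) (out : Z → β),
    Prepares T ψ ∧ ∀ x, 2 / 3 ≤ ∑ z, if out z = f x then ‖ψ x z‖ ^ 2 else 0

theorem Solves.exists_computes [DecidableEq β] {f : (Fin n → Bool) → β} (h : Solves T f)
    (i₀ : Fin n) : ∃ A : QueryAlgorithm n β, A.Computes T f := by
  obtain ⟨Z, _, _, ψ, out, hψ, hf⟩ := h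
  obtain ⟨z₀, U, hU⟩ := hψ.exists_state i₀ fun y => out y.2.2
  refine ⟨QueryAlgorithm.mk Z inferInstance inferInstance (i₀, false, z₀) U fun y => out y.2.2,
    fun x => (hf x).trans_eq ?_⟩
  unfold QueryAlgorithm.outputProb
  simp only [hU x]
  rw [Fintype.sum_prod_type, Finset.sum_eq_single i₀, Fintype.sum_prod_type,
    Finset.sum_eq_single false]
  · simp
  · simp +contextual
  · simp
  · simp +contextual
  · simp

theorem Solves.Q2_le [DecidableEq β] {f : (Fin n → Bool) → β} (h : Solves T f) (i₀ : Fin n) :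
    Q2 f ≤ T :=
  iInf₂_le T (h.exists_computes i₀)

end Compile

/-! ### The polynomial method -/

section Polynomial

variable {n : ℕ}

/-- The real function `g` on the cube is a multilinear polynomial of degree at most `d`. -/
def HasDegreeLE (d : ℕ) (g : (Fin n → Bool) → ℝ) : Prop :=
  ∃ a : Finset (Fin n) → ℝ, (∀ S, d < S.card → a S = 0) ∧ ∀ x, g x = multilinearEval a x

namespace HasDegreeLE

variable {d d' : ℕ} {g h : (Fin n → Bool) → ℝ}

theorem mono (hg : HasDegreeLE d g) (hd : d ≤ d') : HasDegreeLE d' g := by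
  obtain ⟨a, ha, hga⟩ := hg
  exact ⟨a, fun S hS => ha S (hd.trans_lt hS), hga⟩

theorem add (hg : HasDegreeLE d g) (hh : HasDegreeLE d h) :
    HasDegreeLE d fun x => g x + h x := by
  obtain ⟨a, ha, hga⟩ := hg
  obtain ⟨b, hb, hhb⟩ := hh
  refine ⟨fun S => a S + b S, fun S hS => by simp [ha S hS, hb S hS], fun x => ?_⟩
  simp only [hga, hhb, multilinearEval, add_mul, Finset.sum_add_distrib]

theorem const_mul (hg : HasDegreeLE d g) (c : ℝ) : HasDegreeLE d fun x => c * g x := by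
  obtain ⟨a, ha, hga⟩ := hg
  refine ⟨fun S => c * a S, fun S hS => by simp [ha S hS], fun x => ?_⟩
  simp only [hga, multilinearEval, Finset.mul_sum, mul_assoc]

theorem sub (hg : HasDegreeLE d g) (hh : HasDegreeLE d h) :
    HasDegreeLE d fun x => g x - h x := by
  simpa [sub_eq_add_neg] using hg.add (hh.const_mul (-1))

theorem zero : HasDegreeLE d fun _ : Fin n → Bool => (0 : ℝ) :=
  ⟨0, by simp, by simp [multilinearEval]⟩

theorem sum {ι : Type} (s : Finset ι) {g : ι → (Fin n → Bool) → ℝ}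
    (hg : ∀ i ∈ s, HasDegreeLE d (g i)) : HasDegreeLE d fun x => ∑ i ∈ s, g i x := by
  classical
  induction s using Finset.induction_on with
  | empty => simpa using zero
  | insert i s hi ih =>
    simp only [Finset.sum_insert hi]
    exact (hg i (by simp)).add (ih fun j hj => hg j (by simp [hj]))

theorem monomial (S : Finset (Fin n)) (hS : S.card ≤ d) :
    HasDegreeLE d fun x => ∏ i ∈ S, if x i then (1 : ℝ) else 0 := by
  refine ⟨Pi.single S 1, fun S' hS' => ?_, fun x => ?_⟩
  · rw [Pi.single_eq_of_ne]
    rintro rfl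
    omega
  · simp [multilinearEval, Pi.single_apply]

theorem const (c : ℝ) : HasDegreeLE d fun _ : Fin n → Bool => c := by
  simpa using (monomial (d := d) (∅ : Finset (Fin n)) (by simp)).const_mul c

theorem coordinate (i : Fin n) :
    HasDegreeLE 1 fun x : Fin n → Bool => if x i then (1 : ℝ) else 0 := by
  simpa using monomial (d := 1) {i} (by simp)

theorem mul (hg : HasDegreeLE d g) (hh : HasDegreeLE d' h) :
    HasDegreeLE (d + d') fun x => g x * h x := by
  obtain ⟨a, ha, hga⟩ := hg
  obtain ⟨b, hb, hhb⟩ := hh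
  have key : ∀ x : Fin n → Bool, g x * h x = ∑ S, ∑ S', a S * b S' *
      ∏ i ∈ S ∪ S', if x i then (1 : ℝ) else 0 := by
    intro x
    rw [hga, hhb, multilinearEval, multilinearEval, Finset.sum_mul_sum]
    refine Finset.sum_congr rfl fun S _ => Finset.sum_congr rfl fun S' _ => ?_
    rw [mul_mul_mul_comm]
    congr 1
    -- the variables are idempotent on the cube
    simp only [Finset.prod_ite_zero, Finset.prod_const_one, Finset.mem_union, or_imp,
      forall_and, ite_and, mul_ite, mul_one, mul_zero]
    split_ifs <;> rfl
  simp only [key]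
  refine sum _ fun S _ => sum _ fun S' _ => ?_
  by_cases hS : d < S.card
  · simpa [ha S hS] using zero
  by_cases hS' : d' < S'.card
  · simpa [hb S' hS'] using zero
  exact (monomial _ ((Finset.card_union_le S S').trans (by omega))).const_mul _

end HasDegreeLE

variable {β : Type}

/-- Each query raises the degree of the amplitudes by at most one. -/
theorem QueryAlgorithm.hasDegreeLE_state (A : QueryAlgorithm n β) (T : ℕ) :
    ∀ z, HasDegreeLE T (fun x => (A.state x T z).re) ∧
      HasDegreeLE T (fun x => (A.state x T z).im) := by
  have hU : ∀ (d : ℕ) (U : Matrix (Fin n × Bool × A.W) (Fin n × Bool × A.W) ℂ)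
      (ψ : (Fin n → Bool) → Fin n × Bool × A.W → ℂ),
      (∀ z, HasDegreeLE d (fun x => (ψ x z).re) ∧ HasDegreeLE d (fun x => (ψ x z).im)) →
      ∀ z, HasDegreeLE d (fun x => (U.mulVec (ψ x) z).re) ∧
        HasDegreeLE d (fun x => (U.mulVec (ψ x) z).im) := by
    intro d U ψ hψ z
    simp only [Matrix.mulVec, dotProduct, Complex.re_sum, Complex.im_sum, Complex.mul_re,
      Complex.mul_im]
    exact ⟨.sum _ fun w _ => ((hψ w).1.const_mul _).sub ((hψ w).2.const_mul _),
      .sum _ fun w _ => ((hψ w).2.const_mul _).add ((hψ w).1.const_mul _)⟩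
  induction T with
  | zero => exact hU 0 _ (fun _ => Pi.single A.start 1) fun z => ⟨.const _, .const _⟩
  | succ T ih =>
    refine hU (T + 1) _ (fun x => query x (A.state x T)) fun z => ?_
    obtain ⟨i, b, w⟩ := z
    -- the queried amplitude is affine in the bit `x i`
    have hq : ∀ x : Fin n → Bool, query x (A.state x T) (i, b, w) = A.state x T (i, b, w) +
        ((if x i then (1 : ℝ) else 0 : ℝ) : ℂ) *
          (A.state x T (i, !b, w) - A.state x T (i, b, w)) := by
      intro x
      cases hx : x i <;> simp [query, hx]
    have h0 := ih (i, b, w)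
    have h1 := ih (i, !b, w)
    simp only [hq, Complex.add_re, Complex.add_im, Complex.re_ofReal_mul, Complex.im_ofReal_mul,
      Complex.sub_re, Complex.sub_im]
    refine ⟨(h0.1.mono (Nat.le_succ T)).add ?_, (h0.2.mono (Nat.le_succ T)).add ?_⟩
    · rw [Nat.succ_eq_one_add]
      exact (HasDegreeLE.coordinate i).mul (h1.1.sub h0.1)
    · rw [Nat.succ_eq_one_add]
      exact (HasDegreeLE.coordinate i).mul (h1.2.sub h0.2)

theorem QueryAlgorithm.hasDegreeLE_outputProb [DecidableEq β] (A : QueryAlgorithm n β) (T : ℕ)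
    (y : β) : HasDegreeLE (2 * T) fun x => A.outputProb T x y := by
  refine .sum _ fun z _ => ?_
  split_ifs
  · simp only [Complex.sq_norm, Complex.normSq_apply, two_mul]
    have h := A.hasDegreeLE_state T z
    exact (h.1.mul h.1).add (h.2.mul h.2)
  · exact .zero

theorem QueryAlgorithm.sum_norm_sq_state (A : QueryAlgorithm n β) (T : ℕ) (x : Fin n → Bool) :
    ∑ z, ‖A.state x T z‖ ^ 2 = 1 := by
  induction T with
  | zero =>
    simp only [state]
    rw [sum_norm_sq_mulVec, Finset.sum_eq_single A.start] <;> simp +contextual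
  | succ T ih =>
    simp only [state]
    rw [sum_norm_sq_mulVec, ← ih, Fintype.sum_prod_type, Fintype.sum_prod_type]
    refine Finset.sum_congr rfl fun i _ => ?_
    simp only [query, Fintype.sum_prod_type, Fintype.sum_bool]
    cases x i
    · simp
    · simp [add_comm]

theorem QueryAlgorithm.Computes.approxDegree_le {T : ℕ} {f : (Fin n → Bool) → Bool}
    {A : QueryAlgorithm n Bool} (hA : A.Computes T f) : approxDegree f ≤ (2 * T : ℕ) := by
  obtain ⟨a, ha, hp⟩ := A.hasDegreeLE_outputProb T true
  refine (iInf₂_le a fun x => ?_).trans ?_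
  · have htotal : A.outputProb T x true + A.outputProb T x false = 1 := by
      rw [← A.sum_norm_sq_state T x, outputProb, outputProb, ← Finset.sum_add_distrib]
      refine Finset.sum_congr rfl fun z _ => ?_
      cases A.out z <;> simp
    have hnonneg : ∀ y, 0 ≤ A.outputProb T x y := fun y =>
      Finset.sum_nonneg fun z _ => by split_ifs <;> positivity
    have h := hA x
    have h0 := hnonneg true
    have h1 := hnonneg false
    rw [← hp x, abs_le]
    cases hfx : f x <;> rw [hfx] at h <;> simp <;> constructor <;> linarith
  · rw [multilinearDegree]
    norm_cast
    refine Finset.sup_le fun S hS => ?_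
    by_contra hlt
    exact (Finset.mem_filter.1 hS).2 (ha S (not_le.1 hlt))

theorem Solves.approxDegree_le {T : ℕ} {f : (Fin n → Bool) → Bool} (h : Solves T f)
    (i₀ : Fin n) : approxDegree f ≤ (2 * T : ℕ) :=
  (h.exists_computes i₀).elim fun _ hA => hA.approxDegree_le

end Polynomial

/-! ### Hadamard transforms and lookups -/

section Hadamard

variable {D : Type} [Fintype D] [DecidableEq D]

/-- The entries of the one-qubit Hadamard matrix. -/
noncomputable def hadamardEntry (a b : Bool) : ℂ :=
  ((Real.sqrt 2)⁻¹ : ℝ) * ((bitSign (a && b) : ℤ) : ℂ)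

theorem sum_hadamardEntry_mul (a b : Bool) :
    ∑ c, hadamardEntry a c * hadamardEntry c b = if a = b then 1 else 0 := by
  have h : (((Real.sqrt 2)⁻¹ : ℝ) : ℂ) * (((Real.sqrt 2)⁻¹ : ℝ) : ℂ) = 1 / 2 := by
    rw [← Complex.ofReal_mul, ← mul_inv, Real.mul_self_sqrt (by norm_num)]
    norm_num
  cases a <;> cases b <;> simp only [hadamardEntry, bitSign, Fintype.sum_bool] <;>
    simp [-Complex.ofReal_inv, h] <;> norm_num

theorem hadamard_mul_self :
    (Matrix.of fun j v : D → Bool => ∏ d, hadamardEntry (j d) (v d)) *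
      (Matrix.of fun j v : D → Bool => ∏ d, hadamardEntry (j d) (v d)) = 1 := by
  ext j k
  simp only [Matrix.mul_apply, Matrix.of_apply, ← Finset.prod_mul_distrib]
  have := Finset.prod_univ_sum (fun _ : D => (Finset.univ : Finset Bool))
    (fun d c => hadamardEntry (j d) c * hadamardEntry c (k d))
  rw [Fintype.piFinset_univ] at this
  rw [← this]
  simp only [sum_hadamardEntry_mul, Finset.prod_ite_zero, Finset.prod_const_one, Matrix.one_apply,
    funext_iff, Finset.mem_univ, true_imp_iff]

/-- The Hadamard transform on the qubits indexed by `D`. -/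
noncomputable def hadamard (D : Type) [Fintype D] [DecidableEq D] :
    Matrix.unitaryGroup (D → Bool) ℂ :=
  ⟨Matrix.of fun j v => ∏ d, hadamardEntry (j d) (v d), by
    rw [Matrix.mem_unitaryGroup_iff]
    convert hadamard_mul_self using 2
    ext j v
    simp [Matrix.star_apply, hadamardEntry, Bool.and_comm]⟩

theorem hadamard_mulVec_single (j v : D → Bool) :
    (hadamard D).1.mulVec (Pi.single j 1) v = ∏ d, hadamardEntry (v d) (j d) := by
  simp [hadamard]

/-- The Bernstein–Vazirani identity: the Hadamard transform recovers `j` from the uniform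
superposition with the phases `(-1) ^ ⟨j, v⟩`. -/
theorem hadamard_mulVec_phase (j : D → Bool) :
    (hadamard D).1.mulVec (fun v => (((∏ d, bitSign (j d && v d) : ℤˣ) : ℤ) : ℂ) *
      (hadamard D).1.mulVec (Pi.single (fun _ => false) 1) v) = Pi.single j 1 := by
  have h : (fun v => (((∏ d, bitSign (j d && v d) : ℤˣ) : ℤ) : ℂ) *
      (hadamard D).1.mulVec (Pi.single (fun _ => false) 1) v) =
      (hadamard D).1.mulVec (Pi.single j 1) := by
    funext v
    rw [hadamard_mulVec_single, hadamard_mulVec_single]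
    push_cast
    rw [← Finset.prod_mul_distrib]
    refine Finset.prod_congr rfl fun d _ => ?_
    simp [hadamardEntry, bitSign, Bool.and_comm, mul_comm]
  rw [h, Matrix.mulVec_mulVec]
  have : (hadamard D).1 * (hadamard D).1 = 1 := hadamard_mul_self
  rw [this, Matrix.one_mulVec]

/-- One more query looks up the bit whose position has been computed. -/
theorem Solves.lookup {n T : ℕ} {γ : Type} [DecidableEq γ] {g : (Fin n → Bool) → γ}
    (h : Solves T g) (pos : γ → Fin n) : Solves (T + 1) fun x => x (pos (g x)) := by
  obtain ⟨Z, _, _, ψ, out, hψ, hg⟩ := h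
  have hp := (((hψ.addRegister (B := Unit → Bool) fun _ => false).unitary
    (controlled (Equiv.prodComm _ _) fun _ => hadamard Unit)).query
      (fun z => if z.2 () then some (pos (out z.1)) else none)).unitary
    (controlled (Equiv.prodComm _ _) fun _ => hadamard Unit)
  refine ⟨Z × (Unit → Bool), inferInstance, inferInstance, _, fun z => z.2 (), hp, fun x => ?_⟩
  have hval : ∀ z c, (controlled (Equiv.prodComm Z (Unit → Bool)) fun _ => hadamard Unit).1.mulVec
      (fun z => ((phase x (if z.2 () then some (pos (out z.1)) else none) : ℤ) : ℂ) *
        (controlled (Equiv.prodComm Z (Unit → Bool)) fun _ => hadamard Unit).1.mulVec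
          (fun z => ψ x z.1 * (Pi.single (fun _ => false) 1 : (Unit → Bool) → ℂ) z.2) z) (z, c) =
      ψ x z * (Pi.single (fun _ => x (pos (out z))) 1 : (Unit → Bool) → ℂ) c := by
    intro z c
    have hsingle : ∀ c', (hadamard Unit).1.mulVec (fun c => ψ x z *
        (Pi.single (fun _ => false) 1 : (Unit → Bool) → ℂ) c) c' =
        ψ x z * (hadamard Unit).1.mulVec (Pi.single (fun _ => false) 1) c' :=
      congrFun (Matrix.mulVec_smul _ (ψ x z) _)
    have key := congrFun (congrArg (ψ x z • ·)
      (hadamard_mulVec_phase fun _ : Unit => x (pos (out z)))) c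
    simp only [← Matrix.mulVec_smul] at key
    rw [controlled_mulVec]
    refine Eq.trans (congrFun (congrArg _ (funext fun c' => ?_)) c) key
    rw [controlled_mulVec]
    refine Eq.trans (congrArg _ (hsingle c')) ?_
    have hphase : phase x (if c' () then some (pos (out z)) else none) =
        ∏ d, bitSign (x (pos (out z)) && c' d) := by
      cases hc : c' () <;> simp [phase, bitSign, hc]
    change ((phase x (if c' () then some (pos (out z)) else none) : ℤ) : ℂ) * _ = ψ x z * _
    rw [hphase]
    ring
  refine (hg x).trans ?_
  rw [Fintype.sum_prod_type]
  refine Finset.sum_le_sum fun z _ => ?_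
  split_ifs with hz
  · simp only [hval]
    refine le_trans ?_ (Finset.single_le_sum (fun c _ => by split_ifs <;> positivity)
      (Finset.mem_univ fun _ : Unit => x (pos (out z))))
    simp [hz]
  · exact Finset.sum_nonneg fun c _ => by split_ifs <;> positivity

end Hadamard

/-! ### Grover iterations -/

section Grover

variable {P : Type} [Fintype P] [DecidableEq P]

/-- The diagonal unitary with the signs `σ`. -/
def signs (σ : P → ℤˣ) : Matrix.unitaryGroup P ℂ :=
  ⟨Matrix.diagonal fun p => ((σ p : ℤ) : ℂ), by
    rw [Matrix.mem_unitaryGroup_iff, Matrix.star_eq_conjTranspose, Matrix.diagonal_conjTranspose,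
      Matrix.diagonal_mul_diagonal, ← Matrix.diagonal_one]
    congr 1
    funext p
    rcases Int.units_eq_one_or (σ p) with h | h <;> simp [h]⟩

theorem signs_mulVec (σ : P → ℤˣ) (φ : P → ℂ) :
    (signs σ).1.mulVec φ = fun p => ((σ p : ℤ) : ℂ) * φ p := by
  funext p
  simp [signs, Matrix.mulVec_diagonal]

/-- The reflection `2 |s⟩⟨s| - 1` about the uniform superposition `s`. -/
noncomputable def diffusion (P : Type) [Fintype P] [DecidableEq P] : Matrix.unitaryGroup P ℂ :=
  ⟨(2 / (Fintype.card P : ℂ)) • Matrix.of (fun _ _ => 1) - 1, by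
    rw [Matrix.mem_unitaryGroup_iff]
    have hstar : star ((2 / (Fintype.card P : ℂ)) • Matrix.of (fun _ _ => 1) - 1 : Matrix P P ℂ) =
        (2 / (Fintype.card P : ℂ)) • Matrix.of (fun _ _ => 1) - 1 := by
      ext p q
      simp [Matrix.star_apply, Matrix.one_apply, eq_comm]
    rw [hstar]
    rcases isEmpty_or_nonempty P with h | h
    · exact Subsingleton.elim _ _
    have hcard : (Fintype.card P : ℂ) ≠ 0 := by simp
    ext p q
    simp [sub_mul, mul_sub, Matrix.mul_apply, Matrix.one_apply]
    field_simp
    ring⟩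

theorem diffusion_mulVec (φ : P → ℂ) (p : P) :
    (diffusion P).1.mulVec φ p = 2 / Fintype.card P * ∑ q, φ q - φ p := by
  simp [diffusion, Matrix.mulVec, dotProduct, Matrix.one_apply, sub_mul, Finset.mul_sum]

/-- The Grover iteration for the marked set `{p | σ p = -1}`. -/
noncomputable def grover (σ : P → ℤˣ) : Matrix.unitaryGroup P ℂ := diffusion P * signs σ

theorem grover_mulVec (σ : P → ℤˣ) (φ : P → ℂ) (p : P) :
    (grover σ).1.mulVec φ p =
      2 / Fintype.card P * ∑ q, ((σ q : ℤ) : ℂ) * φ q - ((σ p : ℤ) : ℂ) * φ p := by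
  rw [grover, Submonoid.coe_mul, ← Matrix.mulVec_mulVec, signs_mulVec, diffusion_mulVec]

theorem grover_pow_mulVec_of_unmarked {σ : P → ℤˣ} (hσ : ∀ p, σ p = 1) (m : ℕ) :
    (grover σ ^ m).1.mulVec 1 = 1 := by
  induction m with
  | zero => simp
  | succ m ih =>
    rw [pow_succ', Submonoid.coe_mul, ← Matrix.mulVec_mulVec, ih]
    funext p
    have : Nonempty P := ⟨p⟩
    have hcard : (Fintype.card P : ℂ) ≠ 0 := by simp
    rw [grover_mulVec]
    simp [hσ]
    norm_num

/-- If some element is marked, the Grover iterates of the uniform vector cancel on average. Indeed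
`1 = u - G u` where `u` is supported on the marked elements, hence `∑ m < M, G ^ m 1` telescopes to
`u - G ^ M u`, whose norm is bounded independently of `M`. -/
theorem sum_norm_sq_sum_grover_pow_le {σ : P → ℤˣ} (hσ : ∃ p, σ p ≠ 1) (M : ℕ) :
    ∑ p, ‖∑ m ∈ Finset.range M, (grover σ ^ m).1.mulVec 1 p‖ ^ 2 ≤ (Fintype.card P : ℝ) ^ 2 := by
  set N := Fintype.card P with hN
  set S := Finset.univ.filter fun p => σ p ≠ 1 with hS
  have hK : 1 ≤ S.card := Finset.card_pos.2 (hσ.imp fun p hp => by simpa [hS] using hp)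
  set u : P → ℂ := fun p => if σ p ≠ 1 then (N : ℂ) / (2 * S.card) else 0 with hu
  have hN0 : (N : ℂ) ≠ 0 := by
    have : Nonempty P := hσ.nonempty
    simp [hN]
  have hK0 : (S.card : ℂ) ≠ 0 := by
    have : S.card ≠ 0 := by omega
    exact_mod_cast this
  have hσu : ∀ p, ((σ p : ℤ) : ℂ) * u p = - u p := by
    intro p
    rcases Int.units_eq_one_or (σ p) with h | h <;> simp [hu, h]
  have hone : u - (grover σ).1.mulVec u = 1 := by
    funext p
    rw [Pi.sub_apply, grover_mulVec]
    simp only [hσu, Finset.sum_neg_distrib]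
    rw [show ∑ q, u q = N / 2 by
      simp only [hu, ← Finset.sum_filter, Finset.sum_const, nsmul_eq_mul, ← hS]
      field_simp]
    rw [Pi.one_apply, ← hN]
    field_simp
    ring
  have htel : ∀ p, ∑ m ∈ Finset.range M, (grover σ ^ m).1.mulVec 1 p =
      u p - (grover σ ^ M).1.mulVec u p := by
    intro p
    have : ∀ m, (grover σ ^ m).1.mulVec 1 p =
        (grover σ ^ m).1.mulVec u p - (grover σ ^ (m + 1)).1.mulVec u p := by
      intro m
      rw [← hone, Matrix.mulVec_sub, Matrix.mulVec_mulVec, pow_succ]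
      rfl
    simp only [this]
    rw [Finset.sum_range_sub']
    simp
  have hnorm : ∑ p, ‖u p‖ ^ 2 ≤ (N : ℝ) ^ 2 / 4 := by
    have : ∀ p, ‖u p‖ ^ 2 = if σ p ≠ 1 then ((N : ℝ) / (2 * S.card)) ^ 2 else 0 := by
      intro p
      simp only [hu]
      split_ifs <;> simp
    simp only [this, ← Finset.sum_filter, Finset.sum_const, nsmul_eq_mul, ← hS]
    have hK' : (1 : ℝ) ≤ S.card := by exact_mod_cast hK
    rw [show (S.card : ℝ) * (N / (2 * S.card)) ^ 2 = (N : ℝ) ^ 2 / (4 * S.card) by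
      field_simp; norm_num]
    gcongr
    linarith
  calc ∑ p, ‖∑ m ∈ Finset.range M, (grover σ ^ m).1.mulVec 1 p‖ ^ 2
      ≤ ∑ p, (2 * ‖u p‖ ^ 2 + 2 * ‖(grover σ ^ M).1.mulVec u p‖ ^ 2) := by
        refine Finset.sum_le_sum fun p _ => ?_
        rw [htel]
        have := norm_sub_le (u p) ((grover σ ^ M).1.mulVec u p)
        have h0 := norm_nonneg (u p - (grover σ ^ M).1.mulVec u p)
        nlinarith [sq_nonneg (‖u p‖ - ‖(grover σ ^ M).1.mulVec u p‖)]
    _ = 4 * ∑ p, ‖u p‖ ^ 2 := by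
        rw [Finset.sum_add_distrib, ← Finset.mul_sum, ← Finset.mul_sum, sum_norm_sq_mulVec]
        ring
    _ ≤ (N : ℝ) ^ 2 := by linarith

end Grover

/-! ### Verification of a code word -/

section Verify

variable {n N T M : ℕ} {V : Type}

/-- The sign `-1` at the positions `p` where the input bit `e p` differs from the code word of `v`,
and `1` at the others: the signs of the search for a mismatch. -/
def mismatch (e : Fin N → Fin n) (code : V → Fin N → Bool) (x : Fin n → Bool) (v : V)
    (p : Fin N) : ℤˣ :=
  bitSign (code v p) * bitSign (x (e p))

theorem mismatch_eq_one_iff (e : Fin N → Fin n) (code : V → Fin N → Bool) (x : Fin n → Bool)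
    (v : V) (p : Fin N) : mismatch e code x v p = 1 ↔ x (e p) = code v p := by
  unfold mismatch bitSign
  cases code v p <;> cases x (e p) <;> decide

variable [Fintype V] [DecidableEq V]

/-- `r` controlled Grover iterations: if the counter register holds `m`, the Grover iteration is
applied `min m r` times. -/
theorem Prepares.grover_iterations {ξ : (Fin n → Bool) → V → ℂ} (h : Prepares T ξ)
    (e : Fin N → Fin n) (code : V → Fin N → Bool) (hN : 0 < N) (hM : 0 < M) (r : ℕ) :
    Prepares (T + r) fun x (z : V × (Fin M × Fin N)) =>
      ξ x z.1 * ((((Real.sqrt (M * N))⁻¹ : ℝ) : ℂ) *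
        (grover (mismatch e code x z.1) ^ min z.2.1.1 r).1.mulVec 1 z.2.2) := by
  induction r with
  | zero =>
    obtain ⟨U, hU⟩ := exists_unitary_mulVec_single ((⟨0, hM⟩, ⟨0, hN⟩) : Fin M × Fin N)
      (fun _ => (((Real.sqrt (M * N))⁻¹ : ℝ) : ℂ)) (by
        have : (0 : ℝ) < M * N := by positivity
        simp only [Complex.norm_real, Real.norm_eq_abs, sq_abs, inv_pow, Real.sq_sqrt this.le]
        simp
        field_simp)
    rw [add_zero]
    convert (h.addRegister ((⟨0, hM⟩, ⟨0, hN⟩) : Fin M × Fin N)).unitary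
      (controlled (Equiv.prodComm _ _) fun _ => U) using 3 with x z
    rw [controlled_mulVec]
    have := congrFun (congrArg (ξ x z.1 • ·) hU) z.2
    simp only [← Matrix.mulVec_smul] at this
    refine Eq.trans ?_ this.symm
    simp
  | succ r ih =>
    have hq := (ih.query fun z => if r < z.2.1.1 then some (e z.2.2) else none).unitary
      (controlled (B := V × Fin M)
        ⟨fun z => (z.2.2, z.1, z.2.1), fun z => (z.2.1, z.2.2, z.1), fun _ => rfl, fun _ => rfl⟩
        fun b => if r < b.2.1 then diffusion (Fin N) * signs fun p => bitSign (code b.1 p) else 1)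
    rw [← add_assoc]
    convert hq using 3 with x z
    obtain ⟨v, m, p⟩ := z
    rw [controlled_mulVec]
    simp only [Equiv.coe_fn_mk, Equiv.coe_fn_symm_mk]
    split_ifs with hr
    · rw [min_eq_right (by omega), min_eq_right (by omega), pow_succ', Submonoid.coe_mul,
        Submonoid.coe_mul, ← Matrix.mulVec_mulVec, ← Matrix.mulVec_mulVec, signs_mulVec,
        grover_mulVec, diffusion_mulVec]
      simp only [phase, Option.elim, mismatch, Units.val_mul, Int.cast_mul, mul_sub]
      rw [Finset.mul_sum, Finset.mul_sum, Finset.mul_sum, Finset.mul_sum]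
      congr 1
      · refine Finset.sum_congr rfl fun q _ => ?_
        ring
      · ring
    · rw [min_eq_left (by omega), min_eq_left (by omega)]
      simp [phase]

/-- Suppose that `T` queries identify `v` on all inputs that carry the code word of `v`. Then
`M ≥ √(3 N)` further queries recognize that the input carries a code word at all. -/
theorem Solves.of_code {β : Type} [DecidableEq β] {ξ : (Fin n → Bool) → V → ℂ} (h : Prepares T ξ)
    (e : Fin N → Fin n) (code : V → Fin N → Bool) (hN : 0 < N) (hM : 3 * N ≤ M ^ 2)
    (hξ : ∀ x v, (∀ p, x (e p) = code v p) → ξ x = Pi.single v 1)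
    (f : (Fin n → Bool) → β) (decode : V → β) (default : β)
    (hcode : ∀ x v, (∀ p, x (e p) = code v p) → f x = decode v)
    (hdefault : ∀ x, (∀ v, ∃ p, x (e p) ≠ code v p) → f x = default) :
    Solves (T + M) f := by
  have hM0 : 0 < M := by
    rcases Nat.eq_zero_or_pos M with rfl | h
    · omega
    · exact h
  set m₀ : Fin M := ⟨0, hM0⟩
  have hNr : (0 : ℝ) < N := by exact_mod_cast hN
  have hMr : (0 : ℝ) < M := by exact_mod_cast hM0
  -- `R` maps the uniform superposition of the counter to the basis state `m₀`
  obtain ⟨R, hR⟩ := exists_unitary_mulVec_single m₀ (fun _ => (((Real.sqrt M)⁻¹ : ℝ) : ℂ)) (by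
    simp only [Complex.norm_real, Real.norm_eq_abs, sq_abs, inv_pow, Real.sq_sqrt hMr.le]
    simp
    field_simp)
  have hRrow : ∀ m, (star R).1 m₀ m = (((Real.sqrt M)⁻¹ : ℝ) : ℂ) := by
    intro m
    have : R.1 m m₀ = (((Real.sqrt M)⁻¹ : ℝ) : ℂ) := by
      rw [← congrFun hR m]; simp
    change star (R.1 m m₀) = _
    rw [this]
    simp
  have hp := (h.grover_iterations e code hN hM0 M).unitary (controlled (B := V × Fin N)
    ⟨fun z => (z.2.1, z.1, z.2.2), fun z => (z.2.1, z.1, z.2.2), fun _ => rfl, fun _ => rfl⟩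
    fun _ => star R)
  obtain ⟨χ, hχ⟩ : ∃ χ, χ = fun x => (controlled (B := V × Fin N)
    (⟨fun z => (z.2.1, z.1, z.2.2), fun z => (z.2.1, z.1, z.2.2), fun _ => rfl, fun _ => rfl⟩ :
      V × (Fin M × Fin N) ≃ _) fun _ => star R).1.mulVec fun z : V × (Fin M × Fin N) =>
      ξ x z.1 * ((((Real.sqrt (M * N))⁻¹ : ℝ) : ℂ) *
        (grover (mismatch e code x z.1) ^ min z.2.1.1 M).1.mulVec 1 z.2.2) := ⟨_, rfl⟩
  rw [← hχ] at hp
  -- the amplitudes at counter value `m₀`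
  have hval : ∀ x v p, ‖χ x (v, m₀, p)‖ ^ 2 = ‖ξ x v‖ ^ 2 * (((M : ℝ) ^ 2 * N)⁻¹ *
      ‖∑ m ∈ Finset.range M, (grover (mismatch e code x v) ^ m).1.mulVec 1 p‖ ^ 2) := by
    intro x v p
    have : χ x (v, m₀, p) = ξ x v * (((((Real.sqrt M)⁻¹ * (Real.sqrt (M * N))⁻¹ : ℝ) : ℂ)) *
        ∑ m ∈ Finset.range M, (grover (mismatch e code x v) ^ m).1.mulVec 1 p) := by
      rw [hχ, Finset.mul_sum, Finset.mul_sum, ← Fin.sum_univ_eq_sum_range (fun m => _ * (_ * _))]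
      simp only []
      rw [controlled_mulVec]
      simp only [Equiv.coe_fn_mk, Equiv.coe_fn_symm_mk]
      rw [Matrix.mulVec, dotProduct]
      refine Finset.sum_congr rfl fun m _ => ?_
      rw [hRrow, min_eq_left m.2.le]
      push_cast
      ring
    rw [this, norm_mul, norm_mul, mul_pow, mul_pow, Complex.norm_real, Real.norm_eq_abs, sq_abs,
      mul_pow, inv_pow, inv_pow, Real.sq_sqrt hMr.le, Real.sq_sqrt (by positivity)]
    congr 2
    field_simp
  refine ⟨V × (Fin M × Fin N), inferInstance, inferInstance, χ,
    fun z => if z.2.1 = m₀ then decode z.1 else default, hp, fun x => ?_⟩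
  by_cases hx : ∃ v, ∀ p, x (e p) = code v p
  · obtain ⟨v, hv⟩ := hx
    rw [hcode x v hv]
    have hone : ∀ p, ‖χ x (v, m₀, p)‖ ^ 2 = (N : ℝ)⁻¹ := by
      intro p
      rw [hval, hξ x v hv]
      simp only [grover_pow_mulVec_of_unmarked
        fun p => (mismatch_eq_one_iff e code x v p).2 (hv p)]
      simp
      field_simp
    calc (2 / 3 : ℝ) ≤ ∑ p : Fin N, ‖χ x (v, m₀, p)‖ ^ 2 := by
          simp only [hone]
          simp
          rw [mul_inv_cancel₀ hNr.ne']
          norm_num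
      _ = ∑ p : Fin N, if (if m₀ = m₀ then decode v else default) = decode v then
            ‖χ x (v, m₀, p)‖ ^ 2 else 0 := by simp
      _ ≤ _ := by
          rw [Fintype.sum_prod_type]
          refine le_trans ?_ (Finset.single_le_sum (fun v' _ => Finset.sum_nonneg fun z _ => by
            split_ifs <;> positivity) (Finset.mem_univ v))
          rw [Fintype.sum_prod_type]
          exact Finset.single_le_sum (f := fun m => ∑ p : Fin N, if (if m = m₀ then decode v
            else default) = decode v then ‖χ x (v, m, p)‖ ^ 2 else 0)
            (fun m _ => Finset.sum_nonneg fun z _ => by split_ifs <;> positivity)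
            (Finset.mem_univ m₀)
  · push Not at hx
    rw [hdefault x hx]
    have hbad : ∑ z : V × (Fin M × Fin N), (if z.2.1 = m₀ then ‖χ x z‖ ^ 2 else 0) ≤ 1 / 3 := by
      calc ∑ z : V × (Fin M × Fin N), (if z.2.1 = m₀ then ‖χ x z‖ ^ 2 else 0)
          = ∑ v, ‖ξ x v‖ ^ 2 * (((M : ℝ) ^ 2 * N)⁻¹ * ∑ p, ‖∑ m ∈ Finset.range M,
              (grover (mismatch e code x v) ^ m).1.mulVec 1 p‖ ^ 2) := by
            rw [Fintype.sum_prod_type]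
            refine Finset.sum_congr rfl fun v _ => ?_
            rw [Fintype.sum_prod_type, Finset.sum_eq_single m₀ (by simp +contextual) (by simp)]
            simp only [if_true, hval, Finset.mul_sum]
        _ ≤ ∑ v, ‖ξ x v‖ ^ 2 * (((M : ℝ) ^ 2 * N)⁻¹ * (N : ℝ) ^ 2) := by
            gcongr with v
            have := sum_norm_sq_sum_grover_pow_le (σ := mismatch e code x v)
              ((hx v).imp fun p hp => mt (mismatch_eq_one_iff e code x v p).1 hp) M
            rwa [Fintype.card_fin] at this
        _ = N / (M : ℝ) ^ 2 := by
            rw [← Finset.sum_mul, h.sum_norm_sq]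
            field_simp
        _ ≤ 1 / 3 := by
            rw [div_le_div_iff₀ (by positivity) (by norm_num)]
            have : (3 * N : ℝ) ≤ (M : ℝ) ^ 2 := by exact_mod_cast hM
            linarith
    calc (2 / 3 : ℝ) ≤ ∑ z, ‖χ x z‖ ^ 2 -
          ∑ z : V × (Fin M × Fin N), (if z.2.1 = m₀ then ‖χ x z‖ ^ 2 else 0) := by
          rw [hp.sum_norm_sq]
          linarith
      _ ≤ _ := by
          rw [← Finset.sum_sub_distrib]
          refine Finset.sum_le_sum fun z _ => ?_
          by_cases hz : z.2.1 = m₀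
          · rw [if_pos hz]
            simp only [sub_self]
            split_ifs <;> positivity
          · simp [hz]

end Verify

/-! ### A code of `t ^ t` words in `t ^ 2` bits -/

section Code

theorem bitSign_decide (u : ℤˣ) : bitSign (decide (u = -1)) = u := by
  rcases Int.units_eq_one_or u with rfl | rfl <;> decide

/-- The augmented Hadamard code: the word of `j` lists the parities `⟨j, u⟩` of the first `s` bits
of `j` with all `u ∈ {0,1}^s`, and its last bit in the clear. -/
def augmentedHadamardCode {s : ℕ} (j : Option (Fin s) → Bool) : Option (Fin s → Bool) → Bool
  | none => j none
  | some u => decide (∏ l, bitSign (j (some l) && u l) = -1)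

/-- There are `t ^ t` code words in `t ^ 2` bits that `2 t` quantum queries tell apart with
certainty. Each of `t` blocks of `t` bits holds a word of the augmented Hadamard code with
`2 ^ s < t ≤ 2 ^ (s + 1)`; two queries per block identify it by the Bernstein–Vazirani algorithm. -/
theorem exists_code {t : ℕ} (ht : 2 ≤ t) :
    ∃ (V : Type) (_ : Fintype V) (_ : DecidableEq V) (code : V → Fin (t ^ 2) → Bool),
      t ^ t ≤ Fintype.card V ∧ ∀ (n : ℕ) (e : Fin (t ^ 2) → Fin n),
        ∃ ξ : (Fin n → Bool) → V → ℂ, Prepares (2 * t) ξ ∧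
          ∀ x v, (∀ p, x (e p) = code v p) → ξ x = Pi.single v 1 := by
  obtain ⟨s, hs, hs'⟩ : ∃ s, 2 ^ s < t ∧ t ≤ 2 ^ (s + 1) := by
    have hpos : 0 < Nat.clog 2 t := Nat.clog_pos (by norm_num) ht
    refine ⟨Nat.clog 2 t - 1, Nat.pow_pred_clog_lt_self (by norm_num) (by omega), ?_⟩
    rw [Nat.sub_add_cancel hpos]
    exact Nat.le_pow_clog (by norm_num) t
  obtain ⟨κ⟩ : Nonempty (Option (Fin s → Bool) ↪ Fin t) :=
    Function.Embedding.nonempty_of_card_le (by simpa using hs)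
  -- positions of a block outside the range of `κ` repeat letters of the word, by `invFun`
  have hκ := Function.leftInverse_invFun κ.injective
  let grid : Fin t × Fin t ≃ Fin (t ^ 2) := finProdFinEquiv.trans (finCongr (sq t).symm)
  refine ⟨Fin t × Option (Fin s) → Bool, inferInstance, inferInstance,
    fun j p => augmentedHadamardCode (fun o => j ((grid.symm p).1, o))
      (Function.invFun κ (grid.symm p).2), ?_, fun n e => ?_⟩
  · have : Fintype.card (Fin t × Option (Fin s) → Bool) = (2 ^ (s + 1)) ^ t := by
      simp [← pow_mul, mul_comm]
    rw [this]
    exact Nat.pow_le_pow_left hs' t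
  · have hp := ((((Prepares.basis (n := n) fun _ : Fin t × Option (Fin s) => false).unitary
      (hadamard _)).queries Finset.univ fun (i : Fin t × Bool) v =>
        if i.2 then (if v (i.1, none) then some (e (grid (i.1, κ none))) else none)
        else some (e (grid (i.1, κ (some fun l => v (i.1, some l))))))).unitary (hadamard _)
    rw [show 0 + (Finset.univ : Finset (Fin t × Bool)).card = 2 * t by simp [mul_comm]] at hp
    refine ⟨_, hp, fun x j hx => ?_⟩
    refine Eq.trans ?_ (hadamard_mulVec_phase j)
    congr 1
    funext v
    congr 3
    rw [Fintype.prod_prod_type, Fintype.prod_prod_type]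
    refine Finset.prod_congr rfl fun b _ => ?_
    rw [Fintype.prod_option, Fintype.prod_bool]
    congr 1
    · cases hv : v (b, none) <;>
        simp [phase, hx, hκ _, augmentedHadamardCode, bitSign]
    · simp [phase, hx, hκ _, augmentedHadamardCode, bitSign_decide]

end Code

/-! ### Addressing schemes -/

section Addressing

/-- The addressing scheme sends the word of an injective code to its index, and every string that is
not one of the `k` code words in use to the index `0`. -/
theorem exists_addressingScheme {t k : ℕ} (ht : 2 ≤ t) (hk : 2 ≤ k) (hkt : k ≤ t ^ t) :
    ∃ a : (Fin (t ^ 2) → Bool) → Fin k, IsAddressingScheme a ∧ DependsOnAll a ∧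
      ∀ (n : ℕ) (e : Fin (t ^ 2) → Fin n), Solves (4 * t) fun x => a fun p => x (e p) := by
  classical
  obtain ⟨V, _, _, code, hcard, hcode⟩ := exists_code ht
  have hinj : Function.Injective code := by
    intro v w hvw
    obtain ⟨ξ, -, hξ⟩ := hcode _ id
    have hsingle : (Pi.single v 1 : V → ℂ) = Pi.single w 1 :=
      (hξ (code v) v fun _ => rfl).symm.trans (hξ (code v) w fun p => congrFun hvw p)
    by_contra hne
    simpa [Pi.single_eq_of_ne hne] using congrFun hsingle v
  obtain ⟨ι⟩ : Nonempty (Fin k ↪ V) :=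
    Function.Embedding.nonempty_of_card_le (by simpa using hkt.trans hcard)
  let a : (Fin (t ^ 2) → Bool) → Fin k := fun y =>
    if h : ∃ i, code (ι i) = y then h.choose else ⟨0, by omega⟩
  have ha : ∀ i, a (code (ι i)) = i := fun i => by
    have h : ∃ i', code (ι i') = code (ι i) := ⟨i, rfl⟩
    simp only [a, dif_pos h]
    exact ι.injective (hinj h.choose_spec)
  have ha' : ∀ y, a y ≠ ⟨0, by omega⟩ → code (ι (a y)) = y := fun y hy => by
    by_cases h : ∃ i, code (ι i) = y
    · obtain ⟨i, rfl⟩ := h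
      rw [ha]
    · exact absurd (dif_neg h) hy
  refine ⟨a, fun i => ⟨_, ha i⟩, fun p => ⟨code (ι ⟨1, by omega⟩), fun h => ?_⟩, fun n e => ?_⟩
  · rw [ha] at h
    have hflip := ha' _ (by rw [← h]; simp)
    rw [← h] at hflip
    simpa using congrFun hflip p
  · obtain ⟨ξ, hξ, hξcode⟩ := hcode n e
    have hsolves := Solves.of_code (M := 2 * t) hξ e code (by positivity) (by nlinarith) hξcode
      (fun x => a fun p => x (e p)) (fun v => a (code v)) ⟨0, by omega⟩
      (fun x v hv => congrArg a (funext hv))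
      (fun x hx => dif_neg fun ⟨i, hi⟩ => by
        obtain ⟨p, hp⟩ := hx (ι i)
        exact hp (congrFun hi p).symm)
    rwa [← add_mul] at hsolves

theorem dependsOnAll_addressFunction {m k : ℕ} {a : (Fin m → Bool) → Fin k}
    (ha : IsAddressingScheme a) (hdep : DependsOnAll a) : DependsOnAll (addressFunction a) := by
  intro i
  refine Fin.addCases (fun i => ?_) (fun i => ?_) i
  · obtain ⟨y, rfl⟩ := ha i
    refine ⟨Fin.append (fun _ => false) y, ?_⟩
    have hne : ∀ j, Fin.natAdd k j ≠ Fin.castAdd m (a y) := fun j h => by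
      have := congrArg Fin.val h
      simp at this
      omega
    simp [addressFunction, Function.update_of_ne (hne _)]
  · obtain ⟨y, hy⟩ := hdep i
    refine ⟨Fin.append (fun l => decide (l = a y)) y, ?_⟩
    have hne : ∀ l, Fin.castAdd m l ≠ Fin.natAdd k i := fun l h => by
      have := congrArg Fin.val h
      simp at this
      omega
    have hupd : (fun j => Function.update (Fin.append (fun l => decide (l = a y)) y)
        (Fin.natAdd k i) (!y i) (Fin.natAdd k j)) = Function.update y i (!y i) := by
      funext j
      by_cases h : j = i
      · subst h; simp
      · rw [Function.update_of_ne h, Function.update_of_ne (by simpa using h), Fin.append_right]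
    simp only [addressFunction, Fin.append_right, hupd]
    rw [Function.update_of_ne (hne _)]
    simpa using Ne.symm hy

theorem Solves.addressFunction {m k T : ℕ} {a : (Fin m → Bool) → Fin k}
    (h : Solves T fun x : Fin (k + m) → Bool => a fun p => x (Fin.natAdd k p)) :
    Solves (T + 1) (addressFunction a) :=
  h.lookup (Fin.castAdd m)

/-- Grover search computes the conjunction of all variables. -/
theorem solves_and {n M : ℕ} (hn : 0 < n) (hM : 3 * n ≤ M ^ 2) :
    Solves M fun x : Fin n → Bool => decide (∀ i, x i = true) := by
  have h := Solves.of_code (Prepares.basis (n := n) ()) id (fun _ _ => true) hn hM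
    (fun _ _ _ => rfl) (fun x => decide (∀ i, x i = true)) (fun _ => true) false
    (fun x _ hx => by simpa using hx) (fun x hx => by simpa using hx ())
  rwa [zero_add] at h

theorem dependsOnAll_and {n : ℕ} :
    DependsOnAll fun x : Fin n → Bool => decide (∀ i, x i = true) := by
  refine fun i => ⟨fun _ => true, fun h => ?_⟩
  have h' : ∀ j, Function.update (fun _ : Fin n => true) i (!true) j = true := by
    simpa using h.symm
  simpa using h' i

end Addressing

/-! ### The growth of `log n / log log n` -/

section Growth

theorem logb_two_le_self {y : ℝ} (hy : 1 ≤ y) : Real.logb 2 y ≤ y := by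
  rw [Real.logb_le_iff_le_rpow (by norm_num) (by linarith)]
  have := one_add_mul_self_le_rpow_one_add (s := 1) (by norm_num) hy
  norm_num at this
  linarith

theorem one_lt_logb_two {n : ℕ} (hn : 3 ≤ n) : 1 < Real.logb 2 n := by
  have : (3 : ℝ) ≤ n := by exact_mod_cast hn
  rw [Real.lt_logb_iff_rpow_lt (by norm_num) (by linarith)]
  norm_num
  linarith

theorem one_le_logRatio {n : ℕ} (hn : 3 ≤ n) : 1 ≤ logRatio n := by
  have h := one_lt_logb_two hn
  rw [logRatio, one_le_div (Real.logb_pos (by norm_num) h)]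
  exact logb_two_le_self h.le

theorem le_logRatio {t n : ℕ} (hn : 3 ≤ n) (hlow : (t - 1) ^ (t - 1) ≤ n)
    (hupp : n ≤ t ^ t + t ^ 2) : (t : ℝ) ≤ 9 * logRatio n := by
  have hone := one_le_logRatio hn
  rcases Nat.lt_or_ge t 3 with ht | ht
  · have : (t : ℝ) ≤ 2 := by exact_mod_cast Nat.lt_succ_iff.1 ht
    linarith
  obtain ⟨u, rfl⟩ : ∃ u, t = u + 1 := ⟨t - 1, by omega⟩
  rw [Nat.add_sub_cancel] at hlow
  have hu : (2 : ℝ) ≤ u := by exact_mod_cast (by omega : 2 ≤ u)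
  have hn0 : (0 : ℝ) < n := by exact_mod_cast (by omega : 0 < n)
  have hy := one_lt_logb_two hn
  have hlog : 0 < Real.logb 2 (Real.logb 2 n) := Real.logb_pos (by norm_num) hy
  set l := Real.logb 2 ((u + 1 : ℕ) : ℝ) with hl
  have hl0 : 0 < l := Real.logb_pos (by norm_num) (by push_cast; linarith)
  have hlt : l ≤ u + 1 := by
    have := logb_two_le_self (y := ((u + 1 : ℕ) : ℝ)) (by push_cast; linarith)
    push_cast at this ⊢
    rw [hl]; push_cast
    exact this
  -- `log n ≤ (t + 1) log t ≤ t ^ 3`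
  have hnpow : n ≤ (u + 1) ^ (u + 2) := by
    have h2 : (u + 1) ^ 2 ≤ (u + 1) ^ (u + 1) := Nat.pow_le_pow_right (by omega) (by omega)
    have h3 : (u + 1) ^ (u + 2) = (u + 1) ^ (u + 1) * (u + 1) := pow_succ _ _
    nlinarith
  have hyupp : Real.logb 2 n ≤ (u + 2) * l := by
    have : (n : ℝ) ≤ ((u + 1 : ℕ) : ℝ) ^ (u + 2) := by exact_mod_cast hnpow
    have := Real.logb_le_logb_of_le (b := 2) (by norm_num) hn0 this
    rw [Real.logb_pow] at this
    push_cast at this ⊢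
    rw [hl]; push_cast
    exact this
  have hloglog : Real.logb 2 (Real.logb 2 n) ≤ 3 * l := by
    have h3 : Real.logb 2 n ≤ ((u + 1 : ℕ) : ℝ) ^ 3 := by
      push_cast
      nlinarith [mul_le_mul_of_nonneg_left hlt (by linarith : (0 : ℝ) ≤ u + 2),
        mul_nonneg (sub_nonneg.2 hu) (sub_nonneg.2 hu)]
    have := Real.logb_le_logb_of_le (b := 2) (by norm_num) (by linarith) h3
    rw [Real.logb_pow] at this
    exact_mod_cast this
  -- `log n ≥ (t - 1) log (t - 1)` and `log t ≤ 2 log (t - 1)`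
  have hylow : u * Real.logb 2 u ≤ Real.logb 2 n := by
    have : (u : ℝ) ^ u ≤ n := by exact_mod_cast hlow
    have := Real.logb_le_logb_of_le (b := 2) (by norm_num) (by positivity) this
    rwa [Real.logb_pow] at this
  have hl2 : l ≤ 2 * Real.logb 2 u := by
    have : ((u + 1 : ℕ) : ℝ) ≤ (u : ℝ) ^ 2 := by push_cast; nlinarith
    have := Real.logb_le_logb_of_le (b := 2) (by norm_num) (by positivity) this
    rw [Real.logb_pow] at this
    exact_mod_cast this
  rw [logRatio, ← mul_div_assoc, le_div_iff₀ hlog]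
  push_cast
  nlinarith [mul_le_mul_of_nonneg_left hloglog (by linarith : (0 : ℝ) ≤ u + 1),
    mul_le_mul_of_nonneg_left hl2 (by linarith : (0 : ℝ) ≤ u),
    mul_nonneg (sub_nonneg.2 hu) hl0.le]

theorem toENNReal_le_ofReal {q : ℕ∞} {m : ℕ} {r : ℝ} (hq : q ≤ m) (hm : (m : ℝ) ≤ r) :
    (q : ℝ≥0∞) ≤ ENNReal.ofReal r := by
  calc (q : ℝ≥0∞) ≤ ((m : ℕ∞) : ℝ≥0∞) := ENat.toENNReal_le.2 hq
    _ = ENNReal.ofReal m := by simp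
    _ ≤ ENNReal.ofReal r := ENNReal.ofReal_le_ofReal hm

/-- Every `n ≥ 18` is the number of variables of an address function with `n - t ^ 2` of the at
most `t ^ t` addresses that `t ^ 2` bits provide. -/
theorem exists_block_size {n : ℕ} (hn : 18 ≤ n) :
    ∃ t, 3 ≤ t ∧ t ^ 2 + 2 ≤ n ∧ (t - 1) ^ (t - 1) ≤ n ∧ n ≤ t ^ t + t ^ 2 := by
  classical
  have hex : ∃ t, n ≤ t ^ t + t ^ 2 :=
    ⟨n, (Nat.le_self_pow two_ne_zero n).trans (Nat.le_add_left _ _)⟩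
  obtain ⟨t, ht, hmin⟩ : ∃ t, n ≤ t ^ t + t ^ 2 ∧ ∀ s < t, ¬ n ≤ s ^ s + s ^ 2 :=
    ⟨Nat.find hex, Nat.find_spec hex, fun s hs => Nat.find_min hex hs⟩
  have ht3 : 3 ≤ t := by
    by_contra hlt
    interval_cases t <;> omega
  obtain ⟨u, rfl⟩ : ∃ u, t = u + 1 := ⟨t - 1, by omega⟩
  have hu := hmin u (by omega)
  refine ⟨u + 1, ht3, ?_, ?_, ht⟩
  · rcases Nat.lt_or_ge u 3 with h | h
    · interval_cases u <;> omega
    · have : u ^ 3 ≤ u ^ u := Nat.pow_le_pow_right (by omega) h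
      nlinarith
  · rw [Nat.add_sub_cancel]
    omega

end Growth

/-! ### Functions of low complexity in every number of variables -/

theorem theorem4 :
    ∃ C : ℝ,
      (∀ n : ℕ, 3 ≤ n → ∃ f : (Fin n → Bool) → Bool,
        DependsOnAll f ∧
        (Q2 f : ℝ≥0∞) ≤ ENNReal.ofReal (C * logRatio n) ∧
        (approxDegree f : ℝ≥0∞) ≤ ENNReal.ofReal (C * logRatio n)) ∧
      (∀ t : ℕ, 2 ≤ t → ∃ a : (Fin (t ^ 2) → Bool) → Fin (t ^ t),
        IsAddressingScheme a ∧
        DependsOnAll a ∧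
        (Q2 a : ℝ≥0∞) ≤ ENNReal.ofReal (C * t) ∧
        DependsOnAll (addressFunction a) ∧
        (Q2 (addressFunction a) : ℝ≥0∞) ≤ ENNReal.ofReal (C * logRatio (t ^ t + t ^ 2)) ∧
        (approxDegree (addressFunction a) : ℝ≥0∞) ≤
          ENNReal.ofReal (C * logRatio (t ^ t + t ^ 2))) := by
  -- `2 (4 t + 1) ≤ 10 t ≤ 90 log n / log log n`
  have hbound : ∀ {t n : ℕ}, 2 ≤ t → (t : ℝ) ≤ 9 * logRatio n →
      ((4 * t + 1 : ℕ) : ℝ) ≤ 90 * logRatio n ∧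
        ((2 * (4 * t + 1) : ℕ) : ℝ) ≤ 90 * logRatio n := by
    intro t n ht h
    have : (2 : ℝ) ≤ t := by exact_mod_cast ht
    push_cast
    constructor <;> linarith
  refine ⟨90, fun n hn => ?_, fun t ht => ?_⟩
  · rcases Nat.lt_or_ge n 18 with hlt | hge
    · have h := solves_and (n := n) (M := 8) (by omega) (by omega)
      have hone := one_le_logRatio hn
      refine ⟨_, dependsOnAll_and, toENNReal_le_ofReal (h.Q2_le ⟨0, by omega⟩) ?_,
        toENNReal_le_ofReal (h.approxDegree_le ⟨0, by omega⟩) ?_⟩ <;> push_cast <;> linarith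
    · obtain ⟨t, ht, hnt, hlow, hupp⟩ := exists_block_size hge
      obtain ⟨k, rfl⟩ : ∃ k, n = k + t ^ 2 := ⟨n - t ^ 2, by omega⟩
      obtain ⟨a, ha, hdep, hsolves⟩ :=
        exists_addressingScheme (t := t) (k := k) (by omega) (by omega) (by omega)
      have hf := (hsolves _ (Fin.natAdd k)).addressFunction
      have hb := hbound (by omega) (le_logRatio hn hlow hupp)
      exact ⟨addressFunction a, dependsOnAll_addressFunction ha hdep,
        toENNReal_le_ofReal (hf.Q2_le ⟨0, by omega⟩) hb.1,
        toENNReal_le_ofReal (hf.approxDegree_le ⟨0, by omega⟩) hb.2⟩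
  · have htt : 2 ^ 2 ≤ t ^ t :=
      (Nat.pow_le_pow_left ht 2).trans (Nat.pow_le_pow_right (by omega) ht)
    obtain ⟨a, ha, hdep, hsolves⟩ := exists_addressingScheme ht (by omega) le_rfl
    have hf := (hsolves _ (Fin.natAdd (t ^ t))).addressFunction
    have hlow : (t - 1) ^ (t - 1) ≤ t ^ t :=
      (Nat.pow_le_pow_left (Nat.sub_le t 1) _).trans
        (Nat.pow_le_pow_right (by omega) (Nat.sub_le t 1))
    have hb := hbound ht (le_logRatio (by omega) (hlow.trans (Nat.le_add_right _ _)) le_rfl)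
    refine ⟨a, ha, hdep, toENNReal_le_ofReal ((hsolves _ id).Q2_le ⟨0, by positivity⟩) ?_,
      dependsOnAll_addressFunction ha hdep,
      toENNReal_le_ofReal (hf.Q2_le ⟨0, by positivity⟩) hb.1,
      toENNReal_le_ofReal (hf.approxDegree_le ⟨0, by positivity⟩) hb.2⟩
    push_cast
    have : (0 : ℝ) ≤ t := by positivity
    linarith
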